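/- Let $d\ge 1$ be fixed. For $v\in\mathbb{Q}^{d+1}$ and $x\in\mathbb{Q}^d$ write $\bar x=[x^T,1]^T$, and let $\operatorname{sign}(u)=1$ if $u\ge 0$ and $-1$ otherwise. **Problem (two-mode PWA regression).** Given $X\subseteq\mathbb{Q}^d$, a loss $\ell:\mathbb{Q}\to\mathbb{Q}_{\ge 0}$ and data $(x_i,y_i)_{i=1}^N\in(X\times\mathbb{Q})^N$ with $N\ge 2(d+1)$, find a global minimizer of $$\frac1N\sum_{i=1}^N\sum_{j\in\{-1,1\}}\mathbf 1_{h(x_i)=j}\,\ell(y_i-w_j^T\bar x_i)$$ over $w_1,w_{-1}\in\mathbb{Q}^{d+1}$ and over the linear classifiers $h:X\to\{-1,1\}$, i.e. the functions $h(x)=\operatorname{sign}(a^T\bar x)$ with $a\in\mathbb{Q}^{d+1}$ (normal and offset). **Algorithm.** Start with $J^*=+\infty$. For every set $S_h$ of $d$ data points, compute the parameters $a$ of a hyperplane $\{x: a^T\bar x=0\}$ through $S_h$, and let $S_1$, $S_2$ be the sets of data with $a^T\bar x_i>0$ and $a^T\bar x_i<0$. For each of the $2^d$ classifications of $S_h$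 into $S_h^1$ and $S_h^2$, call a given regression program to obtain minimizers $w_1$ and $w_{-1}$ of $\sum\ell(y_i-v^T\bar x_i)$ over $v$, the sums being over $S_1\cup S_h^1$ and $S_2\cup S_h^2$ respectively; let $J$ be $1/N$ times the sum of the two minima, and record $J^*\leftarrow J$, $w^*\leftarrow(w_1,w_{-1})$, $a^*\leftarrow a$ and the classification of $S_h$ if $J<J^*$. At the end, tilt $a^*$ to parameters $\tilde a$ for which the points of the recorded $S_h$ lie strictly on their recorded sides and no other data point changes side (explicitly, $\tilde a=a^*+\varepsilon g$, with $g$ given by Cramer's rule and a small $\varepsilon>0$). Return $J^*,w^*,a^*,\tilde a$. **Time** is the number of executed steps in a unit-cost model: one step per rational arithmetic operation, comparison, loaded constant, evaluation of $\ell$, and loop iteration. **Proposition.** There is a constant $C$ depending only on $d$ such that the following holds for all $X$ and $\ell$. Suppose that the regression program finds, for every finite data set with points in $X$, a minimizer over $v\in\mathbb{Q}^{d+1}$ of $\sum_i\ell(y_i-v^T\bar x_i)$, and that it takes at most $T(N)$ steps on data sets of at most $N$ points, where $T$ is bounded by a polynomial and $T(N)\ge N$ (reading the data is counted). Then for every $N\ge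 2(d+1)$ and all data $(x_i,y_i)_{i=1}^N\in(X\times\mathbb{Q})^N$ in general position (no hyperplane of $\mathbb{Q}^d$ contains $x_i$ for more than $d$ indices $i$), the algorithm solves the problem exactly: $(w^*,h)$ with $h(x)=\operatorname{sign}(\tilde a^T\bar x)$ is a global minimizer with cost $J^*$; moreover, the hyperplane of $a^*$ contains exactly $d$ data points, and $h(x_i)=\operatorname{sign}(a^{*T}\bar x_i)$ for every other data point. The algorithm takes at most $C\,T(N)\,N^d$ steps, which is bounded by a polynomial in $N$. -/

import Mathlib

namespace PWA

/-! ### The regression problem -/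

/-- `v ᵀ x̄` with `x̄ = [xᵀ, 1]ᵀ`: the first `d` entries of `v` multiply `x`, the last one is the
offset. -/
def affineEval {d : ℕ} (v : Fin (d + 1) → ℚ) (x : Fin d → ℚ) : ℚ :=
  (∑ i : Fin d, v i.castSucc * x i) + v (Fin.last d)

/-- The sign with values in the two labels `{-1, +1}`, with `sgn 0 = 1`. -/
def sgn (u : ℚ) : ℤˣ := if 0 ≤ u then 1 else -1

/-- The classifier `x ↦ sign (hᵀ x + b)` on `X ⊆ ℚ^d`; `a` lists the entries of `h`, then `b`. -/
def linearClassifier {d : ℕ} (X : Set (Fin d → ℚ)) (a : Fin (d + 1) → ℚ) : X → ℤˣ :=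
  fun x => sgn (affineEval a x.1)

/-- The class of binary linear classifiers on `X`. -/
def linearClassifiers {d : ℕ} (X : Set (Fin d → ℚ)) : Set (X → ℤˣ) :=
  {h | ∃ a : Fin (d + 1) → ℚ, h = linearClassifier X a}

/-- The mean error of the two-mode piecewise affine model with submodels `w` and classifier `h`. -/
def pwaCost {d N : ℕ} {X : Set (Fin d → ℚ)} (ℓ : ℚ → ℚ) (D : Fin N → X × ℚ)
    (w : ℤˣ → Fin (d + 1) → ℚ) (h : X → ℤˣ) : ℚ :=
  (1 / (N : ℚ)) * ∑ i : Fin N, ∑ j : ℤˣ,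
    if h (D i).1 = j then ℓ ((D i).2 - affineEval (w j) (D i).1.1) else 0

/-- `(w, h)` is a global solution of the error-minimizing two-mode PWA regression problem. -/
def IsGlobalSolution {d N : ℕ} {X : Set (Fin d → ℚ)} (ℓ : ℚ → ℚ) (D : Fin N → X × ℚ)
    (w : ℤˣ → Fin (d + 1) → ℚ) (h : X → ℤˣ) : Prop :=
  h ∈ linearClassifiers X ∧
    ∀ w' : ℤˣ → Fin (d + 1) → ℚ, ∀ h' ∈ linearClassifiers X, pwaCost ℓ D w h ≤ pwaCost ℓ D w' h'

/-- No hyperplane of `ℚ^d` contains more than `d` of the `N` points. -/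
def GeneralPosition {d N : ℕ} (x : Fin N → Fin d → ℚ) : Prop :=
  ∀ (h : Fin d → ℚ) (b : ℚ), h ≠ 0 →
    (Finset.univ.filter fun i : Fin N => (∑ k : Fin d, h k * x i k) + b = 0).card ≤ d

/-! ### Programs with a step count

Programs are polymorphic in the type `R` of numbers, so that numbers can be handled only
through instructions, each of which costs one step. Control flow (loop iterations) costs one
step per iteration through `tick`. -/

/-- Instructions whose result is a number. -/
inductive NumInstr (R : Type) : Type
  | const (q : ℚ)
  | add (a b : R)
  | sub (a b : R)
  | mul (a b : R)
  | div (a b : R)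
  | loss (e : R)

/-- Programs over numbers of type `R` that return a result of type `A`. -/
inductive Prog (R A : Type) : Type
  | ret (a : A) : Prog R A
  | num (i : NumInstr R) (k : R → Prog R A) : Prog R A
  | less (a b : R) (k : Bool → Prog R A) : Prog R A
  | tick (k : Prog R A) : Prog R A

namespace Prog

variable {R A B S : Type}

/-- Sequential composition. -/
def bind : Prog R A → (A → Prog R B) → Prog R B
  | ret a, f => f a
  | num i k, f => num i fun r => bind (k r) f
  | less a b k, f => less a b fun r => bind (k r) f
  | tick k, f => tick (bind k f)

instance : Monad (Prog R) where
  pure := ret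
  bind := bind

/-- The rational number computed by an instruction, for the loss function `ℓ`. -/
def instrValue (ℓ : ℚ → ℚ) : NumInstr ℚ → ℚ
  | .const q => q
  | .add a b => a + b
  | .sub a b => a - b
  | .mul a b => a * b
  | .div a b => a / b
  | .loss e => ℓ e

/-- The result of a program run on rational numbers. -/
def value (ℓ : ℚ → ℚ) : Prog ℚ A → A
  | ret a => a
  | num i k => value ℓ (k (instrValue ℓ i))
  | less a b k => value ℓ (k (decide (a < b)))
  | tick k => value ℓ k

/-- The number of steps of a program run on rational numbers. -/
def steps (ℓ : ℚ → ℚ) : Prog ℚ A → ℕ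
  | ret _ => 0
  | num i k => steps ℓ (k (instrValue ℓ i)) + 1
  | less a b k => steps ℓ (k (decide (a < b))) + 1
  | tick k => steps ℓ k + 1

/-- A single numerical instruction. -/
def instr (i : NumInstr R) : Prog R R := num i ret

/-- A single comparison `a < b`. -/
def isLess (a b : R) : Prog R Bool := less a b ret

/-- The loop `for a in l do s ← f s a`, with initial state `s`. -/
def forEach : List A → S → (S → A → Prog R S) → Prog R S
  | [], s, _ => ret s
  | a :: l, s, f => tick (do
      let s' ← f s a
      forEach l s' f)

/-- Fill an array of length `n`. -/
def tabulate : (n : ℕ) → (Fin n → Prog R R) → Prog R (Fin n → R)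
  | 0, _ => ret Fin.elim0
  | n + 1, f => tick (do
      let r ← f 0
      let t ← tabulate n fun i => f i.succ
      ret (Fin.cons r t))

/-- Loop over all sublists of length `k` of `l` (the `k`-element subsets of the entries). -/
def forSubsets : (k : ℕ) → List A → S → (S → (Fin k → A) → Prog R S) → Prog R S
  | 0, _, s, body => tick (body s Fin.elim0)
  | _ + 1, [], s, _ => tick (ret s)
  | k + 1, a :: l, s, body => tick (do
      let s' ← forSubsets k l s fun t c => body t (Fin.cons a c)
      forSubsets (k + 1) l s' body)

/-- Loop over all `2 ^ k` labelings of `k` objects by `+1` and `-1`. -/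
def forLabelings : (k : ℕ) → S → (S → (Fin k → ℤˣ) → Prog R S) → Prog R S
  | 0, s, body => tick (body s Fin.elim0)
  | k + 1, s, body => tick (do
      let s' ← forLabelings k s fun t q => body t (Fin.cons 1 q)
      forLabelings k s' fun t q => body t (Fin.cons (-1) q))

end Prog

open Prog

/-! ### The algorithm -/

/-- A regression vector in `R^d` with its output. -/
abbrev DataPoint (R : Type) (d : ℕ) : Type := (Fin d → R) × R

/-- Determinant by expansion along the first row. -/
def detProg {R : Type} : (n : ℕ) → (Fin n → Fin n → R) → Prog R R
  | 0, _ => instr (.const 1)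
  | n + 1, M => do
      let zero ← instr (.const 0)
      forEach (List.finRange (n + 1)) zero fun s j => do
        let m ← detProg n fun i k => M i.succ (j.succAbove k)
        let p ← instr (.mul (M 0 j) m)
        if Even j.val then instr (.add s p) else instr (.sub s p)

/-- `v ᵀ x̄`. -/
def affineProg {R : Type} {d : ℕ} (v : Fin (d + 1) → R) (x : Fin d → R) : Prog R R :=
  forEach (List.finRange d) (v (Fin.last d)) fun s i => do
    let p ← instr (.mul (v i.castSucc) (x i))
    instr (.add s p)

/-- Parameters (normal, then offset) of a hyperplane passing through `d` points: the entries are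
the signed maximal minors of the matrix with rows `x̄₁, …, x̄_d`. -/
def hyperplaneProg {R : Type} {d : ℕ} (c : Fin d → DataPoint R d) : Prog R (Fin (d + 1) → R) := do
  let zero ← instr (.const 0)
  let one ← instr (.const 1)
  tabulate (d + 1) fun j => do
    let m ← detProg d fun i k =>
      (Fin.snoc (c i).1 one : Fin (d + 1) → R) (j.succAbove k)
    if Even j.val then pure m else instr (.sub zero m)

/-- The data strictly on the positive side and those strictly on the negative side. -/
def splitProg {R : Type} {d : ℕ} (a : Fin (d + 1) → R) (L : List (DataPoint R d)) :
    Prog R (List (DataPoint R d) × List (DataPoint R d)) := do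
  let zero ← instr (.const 0)
  forEach L ([], []) fun s p => do
    let u ← affineProg a p.1
    let isPos ← isLess zero u
    let isNeg ← isLess u zero
    if isPos then pure (p :: s.1, s.2)
    else if isNeg then pure (s.1, p :: s.2)
    else pure s

/-- Add the points of `c` to the two classes according to their labels `q`. -/
def addLabeled {R : Type} {d : ℕ} (c : Fin d → DataPoint R d) (q : Fin d → ℤˣ)
    (s : List (DataPoint R d) × List (DataPoint R d)) :
    Prog R (List (DataPoint R d) × List (DataPoint R d)) :=
  forEach (List.finRange d) s fun t i =>
    if q i = 1 then pure (c i :: t.1, t.2) else pure (t.1, c i :: t.2)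

/-- The sum of the losses of the affine model `v` over a list of data. -/
def lossSumProg {R : Type} {d : ℕ} (v : Fin (d + 1) → R) (L : List (DataPoint R d)) :
    Prog R R := do
  let zero ← instr (.const 0)
  forEach L zero fun s p => do
    let u ← affineProg v p.1
    let e ← instr (.sub p.2 u)
    let l ← instr (.loss e)
    instr (.add s l)

/-- The best solution found so far. -/
structure Best (R : Type) (d : ℕ) : Type where
  /-- the error `J*` -/
  J : R
  /-- the submodels `w*`, for the labels `+1` and `-1` -/
  w : ℤˣ → Fin (d + 1) → R
  /-- the parameters `(h*, b*)` of the hyperplane -/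
  hyperplane : Fin (d + 1) → R
  /-- the `d` points through which the hyperplane passes -/
  points : Fin d → DataPoint R d
  /-- the labels given to these points -/
  labels : Fin d → ℤˣ

/-- The exhaustive search; `none` stands for `J* = +∞`, and `regress` is the
subroutine for single-mode regression. -/
def searchProg {R : Type} {d N : ℕ}
    (regress : List (DataPoint R d) → Prog R (Fin (d + 1) → R))
    (D : Fin N → DataPoint R d) : Prog R (Option (Best R d)) := do
  let size ← instr (.const (N : ℚ))
  forSubsets d (List.ofFn D) none fun best c => do
    let a ← hyperplaneProg c
    let s ← splitProg a (List.ofFn D)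
    forLabelings d best fun best q => do
      let t ← addLabeled c q s
      let w₁ ← regress t.1
      let w₂ ← regress t.2
      let l₁ ← lossSumProg w₁ t.1
      let l₂ ← lossSumProg w₂ t.2
      let l ← instr (.add l₁ l₂)
      let J ← instr (.div l size)
      let new : Best R d := ⟨J, fun j => if j = 1 then w₁ else w₂, a, c, q⟩
      match best with
      | none => pure (some new)
      | some old => do
          let improved ← isLess J old.J
          pure (if improved then some new else some old)

/-- Absolute value. -/
def absProg {R : Type} (u : R) : Prog R R := do
  let zero ← instr (.const 0)
  let isNeg ← isLess u zero
  if isNeg then instr (.sub zero u) else pure u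

/-- Tilt the hyperplane `a` through the points `c` so that these points fall strictly on the sides
given by `q` and no other point of `L` changes side: the result is `a + ε • g`, where
`g ᵀ x̄ᵢ` is a positive multiple of `qᵢ` (Cramer's rule) and `ε > 0` is small enough. -/
def tiltProg {R : Type} {d : ℕ} (a : Fin (d + 1) → R) (c : Fin d → DataPoint R d)
    (q : Fin d → ℤˣ) (L : List (DataPoint R d)) : Prog R (Fin (d + 1) → R) := do
  let zero ← instr (.const 0)
  let one ← instr (.const 1)
  let minusOne ← instr (.const (-1))
  let row : Fin (d + 1) → Fin (d + 1) → R :=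
    Fin.cons a fun i => (Fin.snoc (c i).1 one : Fin (d + 1) → R)
  let target : Fin (d + 1) → R := Fin.cons zero fun i => if q i = 1 then one else minusOne
  let g ← tabulate (d + 1) fun j =>
    detProg (d + 1) fun i k => if k = j then target i else row i k
  let ε ← forEach L one fun ε p => do
    let u ← affineProg a p.1
    let v ← affineProg g p.1
    let absU ← absProg u
    let absV ← absProg v
    let den ← instr (.add absV one)
    let r ← instr (.div absU den)
    let isOff ← isLess zero r
    let isSmaller ← isLess r ε
    pure (if isOff && isSmaller then r else ε)
  tabulate (d + 1) fun j => do
    let p ← instr (.mul ε (g j))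
    instr (.add (a j) p)

/-- What the algorithm returns. -/
structure Output (R : Type) (d : ℕ) : Type where
  /-- the least error `J*` -/
  J : R
  /-- the submodels `w*` -/
  w : ℤˣ → Fin (d + 1) → R
  /-- the parameters `(h*, b*)` of the hyperplane through `d` points -/
  hyperplane : Fin (d + 1) → R
  /-- the parameters of the linear classifier that produces the best classification -/
  classifier : Fin (d + 1) → R

/-- The exact algorithm for two-mode PWA regression. -/
def exactAlgorithm {R : Type} {d N : ℕ}
    (regress : List (DataPoint R d) → Prog R (Fin (d + 1) → R))
    (D : Fin N → DataPoint R d) : Prog R (Option (Output R d)) := do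
  let best ← searchProg regress D
  match best with
  | none => pure none
  | some b => do
      let a ← tiltProg b.hyperplane b.points b.labels (List.ofFn D)
      pure (some ⟨b.J, b.w, b.hyperplane, a⟩)

/-- The program `regress` solves the single-mode regression problem
`min_v ∑ ℓ (y - vᵀ x̄)` for all finite data sets with points in `X`, in at most `T N` steps for data
sets of at most `N` points. -/
def SolvesRegression {d : ℕ} (X : Set (Fin d → ℚ)) (ℓ : ℚ → ℚ)
    (regress : List (DataPoint ℚ d) → Prog ℚ (Fin (d + 1) → ℚ)) (T : ℕ → ℕ) : Prop :=
  ∀ L : List (DataPoint ℚ d), (∀ p ∈ L, p.1 ∈ X) →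
    (∀ v : Fin (d + 1) → ℚ,
      (L.map fun p => ℓ (p.2 - affineEval ((regress L).value ℓ) p.1)).sum ≤
        (L.map fun p => ℓ (p.2 - affineEval v p.1)).sum) ∧
    ∀ N : ℕ, L.length ≤ N → (regress L).steps ℓ ≤ T N

end PWA

/-! The cost depends on a classifier only through the labels of the data, and the search meets all
the labelings that matter.

Lower bound. The offset of a linear classifier can be raised slightly so that no data point lies on
its hyperplane (`exists_affineEval_pos`). As long as the hyperplane contains fewer than `d` points,
it can be moved within the hyperplanes through these points until it first hits another one, and no
point crosses it (`GeneralPosition.exists_card_zeroSet_lt`). In general position this ends with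
exactly `d` points, and the hyperplane is then the one given by their maximal minors, up to a
scalar. A negative scalar only exchanges the labels, which is undone by exchanging the submodels.
Hence some candidate of the search induces the same partition of the data
(`GeneralPosition.exists_hyperplane`), and exact regression on each class makes its error at most
the given cost (`candidate_J_le`).

Attainment. Every candidate is realized by a linear classifier: Cramer's rule gives a direction with
prescribed signs at the `d` points, and a small step along it leaves the other signs unchanged
(`sgn_value_tiltProg`). So the least candidate error is a cost that is really attained
(`candidate_J_eq`).

Running time. There are `O(N^d)` subsets. Each needs `2^d` pairs of regressions and work linear in
`N`, which `T N ≥ N` absorbs. -/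

namespace PWA

/-! ### Values and step counts of composed programs. -/

namespace Prog

variable {A B S : Type} (ℓ : ℚ → ℚ)

@[simp] theorem value_pure (a : A) : (pure a : Prog ℚ A).value ℓ = a := rfl

@[simp] theorem steps_pure (a : A) : (pure a : Prog ℚ A).steps ℓ = 0 := rfl

@[simp] theorem value_instr (i : NumInstr ℚ) : (instr i).value ℓ = instrValue ℓ i := rfl

@[simp] theorem steps_instr (i : NumInstr ℚ) : (instr i).steps ℓ = 1 := rfl

@[simp] theorem value_isLess (a b : ℚ) : (isLess a b).value ℓ = decide (a < b) := rfl

@[simp] theorem steps_isLess (a b : ℚ) : (isLess a b).steps ℓ = 1 := rfl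

@[simp] theorem value_bind (p : Prog ℚ A) (f : A → Prog ℚ B) :
    (p >>= f).value ℓ = (f (p.value ℓ)).value ℓ := by
  change (Prog.bind p f).value ℓ = _
  induction p with
  | ret a => rfl
  | num i k ih => exact ih _
  | less a b k ih => exact ih _
  | tick k ih => exact ih

@[simp] theorem steps_bind (p : Prog ℚ A) (f : A → Prog ℚ B) :
    (p >>= f).steps ℓ = p.steps ℓ + (f (p.value ℓ)).steps ℓ := by
  change (Prog.bind p f).steps ℓ = _
  induction p with
  | ret a => simp [Prog.bind, steps, value]
  | num i k ih => simp only [Prog.bind, steps, value, ih]; omega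
  | less a b k ih => simp only [Prog.bind, steps, value, ih]; omega
  | tick k ih => simp only [Prog.bind, steps, value, ih]; omega

/-! ### Loops -/

@[simp] theorem value_forEach (l : List A) (s : S) (f : S → A → Prog ℚ S) :
    (forEach l s f).value ℓ = l.foldl (fun s a => (f s a).value ℓ) s := by
  induction l generalizing s with
  | nil => rfl
  | cons a l ih => simp only [forEach, value, value_bind, ih, List.foldl_cons]

theorem steps_forEach_le (l : List A) (s : S) (f : S → A → Prog ℚ S) {b : ℕ}
    (hf : ∀ s, ∀ a ∈ l, (f s a).steps ℓ ≤ b) :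
    (forEach l s f).steps ℓ ≤ l.length * (b + 1) := by
  induction l generalizing s with
  | nil => simp [forEach, steps]
  | cons a l ih =>
    have h₁ := hf s a (by simp)
    have h₂ := ih ((f s a).value ℓ) fun s a' ha' => hf s a' (by simp [ha'])
    simp only [forEach, steps, steps_bind, List.length_cons]
    linarith

@[simp] theorem value_tabulate (n : ℕ) (f : Fin n → Prog ℚ ℚ) :
    (tabulate n f).value ℓ = fun i => (f i).value ℓ := by
  induction n with
  | zero => funext i; exact i.elim0
  | succ n ih =>
    simp only [tabulate, value, value_bind, ih]
    funext i
    refine Fin.cases ?_ (fun i => ?_) i <;> simp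

theorem steps_tabulate_le (n : ℕ) (f : Fin n → Prog ℚ ℚ) {b : ℕ}
    (hf : ∀ i, (f i).steps ℓ ≤ b) : (tabulate n f).steps ℓ ≤ n * (b + 1) := by
  induction n with
  | zero => simp [tabulate, steps]
  | succ n ih =>
    have h₁ := hf 0
    have h₂ := ih (fun i => f i.succ) fun i => hf i.succ
    simp only [tabulate, steps, steps_bind]
    linarith

/-- The sublists of length `k` of a list, as functions on `Fin k`. -/
def subsets : (k : ℕ) → List A → List (Fin k → A)
  | 0, _ => [Fin.elim0]
  | _ + 1, [] => []
  | k + 1, a :: l => (subsets k l).map (Fin.cons a) ++ subsets (k + 1) l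

theorem mem_subsets {k : ℕ} {l : List A} {c : Fin k → A} :
    c ∈ subsets k l ↔ List.Sublist (List.ofFn c) l := by
  induction l generalizing k with
  | nil =>
    cases k with
    | zero => simp [subsets, Subsingleton.elim c Fin.elim0]
    | succ k => simp [subsets]
  | cons a l ih =>
    cases k with
    | zero => simp [subsets, Subsingleton.elim c Fin.elim0]
    | succ k =>
      simp only [subsets, List.mem_append, List.mem_map, ih]
      rw [List.ofFn_succ, List.cons_sublist_cons', ← List.ofFn_succ, or_comm]
      refine or_congr Iff.rfl ⟨?_, ?_⟩
      · rintro ⟨t, ht, rfl⟩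
        simpa using ht
      · rintro ⟨h₁, h₂⟩
        exact ⟨_, h₂, by rw [← h₁]; exact Fin.cons_self_tail c⟩

theorem value_forSubsets (k : ℕ) (l : List A) (s : S) (body : S → (Fin k → A) → Prog ℚ S) :
    (forSubsets k l s body).value ℓ =
      (subsets k l).foldl (fun s c => (body s c).value ℓ) s := by
  induction l generalizing k s with
  | nil => cases k <;> rfl
  | cons a l ih =>
    cases k with
    | zero => rfl
    | succ k =>
      simp only [forSubsets, value, value_bind, ih, subsets, List.foldl_append, List.foldl_map]

/-- The form of the bound is dictated by the Pascal-type recursion: splitting one factor of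
`(l.length + 2) ^ (k + 1)` covers both recursive calls and leaves `(b + 1) * (l.length + 2) ^ k`,
which pays for the extra tick. -/
theorem steps_forSubsets_le (k : ℕ) (l : List A) (s : S) (body : S → (Fin k → A) → Prog ℚ S)
    {b : ℕ} (hb : ∀ s, ∀ c ∈ subsets k l, (body s c).steps ℓ ≤ b) :
    (forSubsets k l s body).steps ℓ ≤ (k + 1) * (b + 1) * (l.length + 1) ^ k := by
  induction l generalizing k s with
  | nil =>
    cases k with
    | zero =>
      have := hb s Fin.elim0 (by simp [subsets])
      simp only [forSubsets, steps]
      simpa using this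
    | succ k =>
      simp only [forSubsets, steps, List.length_nil]
      exact Nat.one_le_iff_ne_zero.2 (by positivity)
  | cons a l ih =>
    cases k with
    | zero =>
      have := hb s Fin.elim0 (by simp [subsets])
      simp only [forSubsets, steps]
      simpa using this
    | succ k =>
      have h₁ := ih k s (fun t c => body t (Fin.cons a c)) fun s c hc =>
        hb s _ (by simp only [subsets, List.mem_append, List.mem_map]; exact .inl ⟨c, hc, rfl⟩)
      have h₂ := fun s' => ih (k + 1) s' body fun s c hc =>
        hb s c (by simp only [subsets, List.mem_append]; exact .inr hc)
      simp only [forSubsets, steps, steps_bind, List.length_cons]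
      refine (Nat.add_le_add_right (Nat.add_le_add h₁ (h₂ _)) 1).trans ?_
      have h₃ : (l.length + 1) ^ k ≤ (l.length + 1 + 1) ^ k := Nat.pow_le_pow_left (by omega) k
      have h₄ : 1 ≤ (l.length + 1 + 1) ^ k := Nat.one_le_pow _ _ (by omega)
      calc (k + 1) * (b + 1) * (l.length + 1) ^ k
            + (k + 1 + 1) * (b + 1) * (l.length + 1) ^ (k + 1) + 1
          = (k + 1) * (b + 1) * (l.length + 1) ^ k
            + (k + 1 + 1) * (b + 1) * (l.length + 1) * (l.length + 1) ^ k + 1 := by ring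
        _ ≤ (k + 1) * (b + 1) * (l.length + 1 + 1) ^ k
            + (k + 1 + 1) * (b + 1) * (l.length + 1) * (l.length + 1 + 1) ^ k
            + (b + 1) * (l.length + 1 + 1) ^ k := by
          gcongr
          exact Nat.one_le_iff_ne_zero.2 (by positivity)
        _ = _ := by ring

/-- All labelings of `k` objects by `+1` and `-1`. -/
def labelings : (k : ℕ) → List (Fin k → ℤˣ)
  | 0 => [Fin.elim0]
  | k + 1 => (labelings k).map (Fin.cons 1) ++ (labelings k).map (Fin.cons (-1))

theorem mem_labelings {k : ℕ} (q : Fin k → ℤˣ) : q ∈ labelings k := by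
  induction k with
  | zero => simp [labelings, Subsingleton.elim q Fin.elim0]
  | succ k ih =>
    simp only [labelings, List.mem_append, List.mem_map]
    rcases Int.units_eq_one_or (q 0) with h | h
    · exact .inl ⟨_, ih (Fin.tail q), by rw [← h]; exact Fin.cons_self_tail q⟩
    · exact .inr ⟨_, ih (Fin.tail q), by rw [← h]; exact Fin.cons_self_tail q⟩

theorem value_forLabelings (k : ℕ) (s : S) (body : S → (Fin k → ℤˣ) → Prog ℚ S) :
    (forLabelings k s body).value ℓ =
      (labelings k).foldl (fun s c => (body s c).value ℓ) s := by
  induction k generalizing s with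
  | zero => rfl
  | succ k ih =>
    simp only [forLabelings, value, value_bind, ih, labelings, List.foldl_append, List.foldl_map]

theorem steps_forLabelings_le (k : ℕ) (s : S) (body : S → (Fin k → ℤˣ) → Prog ℚ S)
    {b : ℕ} (hb : ∀ s c, (body s c).steps ℓ ≤ b) :
    (forLabelings k s body).steps ℓ ≤ 2 ^ k * (b + 2) := by
  -- The additional `+ 1` makes the induction close: two such units come from the subtrees, one pays
  -- for the tick at the node.
  suffices h : (forLabelings k s body).steps ℓ + 1 ≤ 2 ^ k * (b + 2) by omega
  induction k generalizing s with
  | zero =>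
    have := hb s Fin.elim0
    simp only [forLabelings, steps]
    omega
  | succ k ih =>
    have h₁ := ih s (fun t q => body t (Fin.cons 1 q)) fun s c => hb s _
    have h₂ := fun s => ih s (fun t q => body t (Fin.cons (-1) q)) fun s c => hb s _
    have h₃ := h₂ ((forLabelings k s fun t q => body t (Fin.cons 1 q)).value ℓ)
    simp only [forLabelings, steps, steps_bind]
    rw [pow_succ, mul_right_comm]
    omega

end Prog

end PWA

namespace PWA

open Matrix

variable {d N : ℕ}

/-! ### Hyperplanes through `d` points -/

/-- The vector `x̄ = [xᵀ, 1]ᵀ`. -/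
def homogenize (x : Fin d → ℚ) : Fin (d + 1) → ℚ := Fin.snoc x 1

theorem affineEval_eq_dotProduct (v : Fin (d + 1) → ℚ) (x : Fin d → ℚ) :
    affineEval v x = homogenize x ⬝ᵥ v := by
  simp [affineEval, homogenize, dotProduct, Fin.sum_univ_castSucc, mul_comm]

theorem affineEval_add (v w : Fin (d + 1) → ℚ) (x : Fin d → ℚ) :
    affineEval (v + w) x = affineEval v x + affineEval w x := by
  simp [affineEval_eq_dotProduct]

theorem affineEval_smul (t : ℚ) (v : Fin (d + 1) → ℚ) (x : Fin d → ℚ) :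
    affineEval (t • v) x = t * affineEval v x := by
  simp [affineEval_eq_dotProduct]

/-- The signed maximal minors of the matrix with rows `x̄₁, …, x̄_d`. -/
def minorVector (y : Fin d → Fin d → ℚ) : Fin (d + 1) → ℚ := fun j =>
  (-1) ^ j.val * det (of fun i k => homogenize (y i) (j.succAbove k))

/-- Laplace expansion along the first row. Incidence with the hyperplane thereby becomes the
vanishing of a determinant. -/
theorem dotProduct_minorVector (u : Fin (d + 1) → ℚ) (y : Fin d → Fin d → ℚ) :
    u ⬝ᵥ minorVector y =
      det (of (Fin.cons u fun i => homogenize (y i) : Fin (d + 1) → Fin (d + 1) → ℚ)) := by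
  rw [det_succ_row_zero]
  refine Finset.sum_congr rfl fun j _ => ?_
  have h : (of (Fin.cons u fun i => homogenize (y i) : Fin (d + 1) → Fin (d + 1) → ℚ)).submatrix
      Fin.succ j.succAbove = of fun i k => homogenize (y i) (j.succAbove k) := by
    ext i k; simp
  rw [h, minorVector]
  simp only [of_apply, Fin.cons_zero]
  ring

theorem affineEval_minorVector (y : Fin d → Fin d → ℚ) (k : Fin d) :
    affineEval (minorVector y) (y k) = 0 := by
  rw [affineEval_eq_dotProduct, dotProduct_minorVector]
  refine det_zero_of_row_eq (i := 0) (j := k.succ) (Fin.succ_ne_zero k).symm ?_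
  ext; simp

/-! ### General position -/

/-- The data points on the hyperplane with parameters `v`. -/
def zeroSet (x : Fin N → Fin d → ℚ) (v : Fin (d + 1) → ℚ) : Finset (Fin N) :=
  Finset.univ.filter fun i => affineEval v (x i) = 0

@[simp] theorem mem_zeroSet {x : Fin N → Fin d → ℚ} {v : Fin (d + 1) → ℚ} {i : Fin N} :
    i ∈ zeroSet x v ↔ affineEval v (x i) = 0 := by
  simp [zeroSet]

/-- `GeneralPosition` speaks only of nonzero normals; with zero normal and nonzero offset no point
is a zero at all. -/
theorem GeneralPosition.card_zeroSet_le {x : Fin N → Fin d → ℚ} (hx : GeneralPosition x)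
    {v : Fin (d + 1) → ℚ} (hv : v ≠ 0) : (zeroSet x v).card ≤ d := by
  by_cases h : (fun i : Fin d => v i.castSucc) = 0
  · have hlast : v (Fin.last d) ≠ 0 := fun hl => hv <| by
      funext j
      exact Fin.lastCases hl (fun i => congrFun h i) j
    have : zeroSet x v = ∅ := by
      ext i
      have h' : ∀ j : Fin d, v j.castSucc = 0 := congrFun h
      simp [affineEval, h', hlast]
    simp [this]
  · exact hx _ (v (Fin.last d)) h

theorem GeneralPosition.exists_affineEval_ne_zero {x : Fin N → Fin d → ℚ} (hx : GeneralPosition x)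
    {v : Fin (d + 1) → ℚ} (hv : v ≠ 0) {s : Finset (Fin N)} (hs : d < s.card) :
    ∃ i ∈ s, affineEval v (x i) ≠ 0 := by
  by_contra! h
  have h₁ : s ⊆ zeroSet x v := fun i hi => mem_zeroSet.2 (h i hi)
  exact absurd (Finset.card_le_card h₁) (by have := hx.card_zeroSet_le hv; omega)

/-- If the determinant vanished for a further point, a kernel vector of the matrix would be a
hyperplane through `d + 1` data points. -/
theorem GeneralPosition.affineEval_minorVector_eq_zero_iff {x : Fin N → Fin d → ℚ}
    (hx : GeneralPosition x) {e : Fin d → Fin N} (he : Function.Injective e) (i : Fin N) :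
    affineEval (minorVector (x ∘ e)) (x i) = 0 ↔ i ∈ Set.range e := by
  constructor
  · intro h
    by_contra hi
    rw [affineEval_eq_dotProduct, dotProduct_minorVector, ← exists_mulVec_eq_zero_iff] at h
    obtain ⟨v, hv, hv0⟩ := h
    have hcard : d < (insert i (Finset.univ.image e)).card := by
      rw [Finset.card_insert_of_notMem (by simpa using hi), Finset.card_image_of_injective _ he]
      simp
    obtain ⟨j, hj, hj0⟩ := hx.exists_affineEval_ne_zero hv hcard
    refine hj0 ?_
    rw [affineEval_eq_dotProduct]
    rcases Finset.mem_insert.1 hj with rfl | hj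
    · simpa [mulVec] using congrFun hv0 0
    · obtain ⟨k, -, rfl⟩ := Finset.mem_image.1 hj
      simpa [mulVec] using congrFun hv0 k.succ
  · rintro ⟨k, rfl⟩
    exact affineEval_minorVector (x ∘ e) k

theorem GeneralPosition.minorVector_ne_zero {x : Fin N → Fin d → ℚ}
    (hx : GeneralPosition x) (hN : d < N) {e : Fin d → Fin N} (he : Function.Injective e) :
    minorVector (x ∘ e) ≠ 0 := by
  intro h
  have hr : Function.Surjective e := fun i =>
    (hx.affineEval_minorVector_eq_zero_iff he i).1 (by simp [h, affineEval])
  have := Fintype.card_le_of_surjective e hr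
  simp at this
  omega

theorem GeneralPosition.card_zeroSet_minorVector {x : Fin N → Fin d → ℚ}
    (hx : GeneralPosition x) {e : Fin d → Fin N} (he : Function.Injective e) :
    (zeroSet x (minorVector (x ∘ e))).card = d := by
  have : zeroSet x (minorVector (x ∘ e)) = Finset.univ.image e := by
    ext i
    simp [hx.affineEval_minorVector_eq_zero_iff he]
  rw [this, Finset.card_image_of_injective _ he]
  simp

/-- A hyperplane through the same `d` points is unique. -/
theorem GeneralPosition.exists_eq_smul_minorVector {x : Fin N → Fin d → ℚ}
    (hx : GeneralPosition x) (hN : d < N) {e : Fin d → Fin N} (he : Function.Injective e)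
    {a : Fin (d + 1) → ℚ} (ha : a ≠ 0) (hae : ∀ k, affineEval a (x (e k)) = 0) :
    ∃ t : ℚ, t ≠ 0 ∧ minorVector (x ∘ e) = t • a := by
  obtain ⟨i, hi⟩ : ∃ i, i ∉ Set.range e := by
    by_contra! h
    have := Fintype.card_le_of_surjective e h
    simp at this
    omega
  have hm : affineEval (minorVector (x ∘ e)) (x i) ≠ 0 := fun h =>
    hi ((hx.affineEval_minorVector_eq_zero_iff he i).1 h)
  have hcard : d < (insert i (Finset.univ.image e)).card := by
    rw [Finset.card_insert_of_notMem (by simpa using hi), Finset.card_image_of_injective _ he]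
    simp
  have ha0 : affineEval a (x i) ≠ 0 := by
    obtain ⟨j, hj, hj0⟩ := hx.exists_affineEval_ne_zero ha hcard
    rcases Finset.mem_insert.1 hj with rfl | hj
    · exact hj0
    · obtain ⟨k, -, rfl⟩ := Finset.mem_image.1 hj
      exact absurd (hae k) hj0
  -- This ratio makes `minorVector (x ∘ e) - t • a` vanish at `x i` too, hence at `d + 1` points, so
  -- it must be zero.
  set t := affineEval (minorVector (x ∘ e)) (x i) / affineEval a (x i) with ht
  refine ⟨t, div_ne_zero hm ha0, ?_⟩
  by_contra hne
  have hv : minorVector (x ∘ e) + (-t) • a ≠ 0 := by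
    rwa [neg_smul, ← sub_eq_add_neg, sub_ne_zero]
  obtain ⟨j, hj, hj0⟩ := hx.exists_affineEval_ne_zero hv hcard
  rw [affineEval_add, affineEval_smul] at hj0
  rcases Finset.mem_insert.1 hj with rfl | hj
  · exact hj0 (by rw [ht]; field_simp; ring)
  · obtain ⟨k, -, rfl⟩ := Finset.mem_image.1 hj
    exact hj0 (by
      rw [hae k, (hx.affineEval_minorVector_eq_zero_iff he (e k)).2 ⟨k, rfl⟩]; simp)

/-! ### Moving a separating hyperplane onto data points -/

/-- At most `d` homogeneous equations in `d + 1` unknowns. -/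
theorem exists_ne_zero_affineEval_eq_zero (x : Fin N → Fin d → ℚ) {s : Finset (Fin N)}
    (hs : s.card ≤ d) : ∃ b : Fin (d + 1) → ℚ, b ≠ 0 ∧ ∀ i ∈ s, affineEval b (x i) = 0 := by
  let F : (Fin (d + 1) → ℚ) →ₗ[ℚ] (s → ℚ) := Matrix.mulVecLin (of fun i => homogenize (x i))
  have hF : LinearMap.ker F ≠ ⊥ := F.ker_ne_bot_of_finrank_lt (by simp; omega)
  obtain ⟨b, hb, hb0⟩ := (Submodule.ne_bot_iff _).1 hF
  refine ⟨b, hb0, fun i hi => ?_⟩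
  rw [affineEval_eq_dotProduct]
  exact congrFun (LinearMap.mem_ker.1 hb) ⟨i, hi⟩

/-- Moving along a direction `b` that vanishes at the current zeros keeps them on the hyperplane;
stopping at the first new zero keeps every point weakly on the side recorded by `σ`. The extra zero
`i₀` of `b` keeps the parameters from becoming zero. -/
theorem GeneralPosition.exists_card_zeroSet_lt {x : Fin N → Fin d → ℚ} (hx : GeneralPosition x)
    (hN : d < N) {σ : Fin N → ℚ} (hσ : ∀ i, σ i ≠ 0) {a : Fin (d + 1) → ℚ}
    (hσa : ∀ i, 0 ≤ σ i * affineEval a (x i)) (hcard : (zeroSet x a).card < d) :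
    ∃ a' : Fin (d + 1) → ℚ, a' ≠ 0 ∧ (∀ i, 0 ≤ σ i * affineEval a' (x i)) ∧
      (zeroSet x a).card < (zeroSet x a').card := by
  obtain ⟨i₀, hi₀⟩ : ∃ i, i ∉ zeroSet x a := by
    by_contra! h
    have := Finset.card_le_card (fun i _ => h i : Finset.univ ⊆ zeroSet x a)
    simp at this
    omega
  obtain ⟨b, hb, hbs⟩ := exists_ne_zero_affineEval_eq_zero x (s := insert i₀ (zeroSet x a))
    (by rw [Finset.card_insert_of_notMem hi₀]; omega)
  -- Replacing `b` by `-b` if necessary, the motion brings some point closer to the hyperplane.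
  obtain ⟨b, hbs, i₁, hi₁⟩ : ∃ b : Fin (d + 1) → ℚ,
      (∀ i ∈ insert i₀ (zeroSet x a), affineEval b (x i) = 0) ∧
        ∃ i, σ i * affineEval b (x i) < 0 := by
    obtain ⟨i, -, hi⟩ := hx.exists_affineEval_ne_zero hb (s := Finset.univ) (by simpa using hN)
    rcases lt_or_gt_of_ne (mul_ne_zero (hσ i) hi) with h | h
    · exact ⟨b, hbs, i, h⟩
    · refine ⟨(-1 : ℚ) • b, fun j hj => by rw [affineEval_smul, hbs j hj, mul_zero], i, ?_⟩
      rw [affineEval_smul]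
      linarith
  -- Ratio test: among the points being approached, `i₂` is reached first, at time `t`.
  obtain ⟨i₂, hi₂, hmin⟩ := Finset.exists_min_image
    (Finset.univ.filter fun i => σ i * affineEval b (x i) < 0)
    (fun i => σ i * affineEval a (x i) / -(σ i * affineEval b (x i))) ⟨i₁, by simpa using hi₁⟩
  simp only [Finset.mem_filter, Finset.mem_univ, true_and] at hi₂ hmin
  set t := σ i₂ * affineEval a (x i₂) / -(σ i₂ * affineEval b (x i₂)) with ht
  have ht0 : 0 ≤ t := div_nonneg (hσa i₂) (by linarith)
  have heval : ∀ i, affineEval (a + t • b) (x i) = affineEval a (x i) + t * affineEval b (x i) :=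
    fun i => by rw [affineEval_add, affineEval_smul]
  have hi₂0 : affineEval (a + t • b) (x i₂) = 0 := by
    have : σ i₂ * affineEval b (x i₂) ≠ 0 := hi₂.ne
    refine (mul_eq_zero.1 (?_ : σ i₂ * affineEval (a + t • b) (x i₂) = 0)).resolve_left (hσ i₂)
    have h₁ : t * -(σ i₂ * affineEval b (x i₂)) = σ i₂ * affineEval a (x i₂) :=
      div_mul_cancel₀ _ (neg_ne_zero.2 this)
    rw [heval]
    linear_combination -h₁
  have hi₂a : i₂ ∉ zeroSet x a := fun h => by
    rw [hbs i₂ (Finset.mem_insert_of_mem h)] at hi₂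
    simp at hi₂
  refine ⟨a + t • b, fun h => ?_, fun i => ?_, ?_⟩
  · have h₁ := heval i₀
    rw [h, hbs i₀ (Finset.mem_insert_self _ _)] at h₁
    simp only [mem_zeroSet] at hi₀
    exact hi₀ (by simpa [affineEval] using h₁.symm)
  · rw [heval, mul_add, mul_left_comm]
    rcases lt_or_ge (σ i * affineEval b (x i)) 0 with h | h
    · have := (le_div_iff₀ (by linarith)).1 (hmin i h)
      linarith
    · exact add_nonneg (hσa i) (mul_nonneg ht0 h)
  · refine Finset.card_lt_card (Finset.ssubset_iff_of_subset (fun i hi => ?_) |>.2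
      ⟨i₂, mem_zeroSet.2 hi₂0, hi₂a⟩)
    rw [mem_zeroSet, heval, hbs i (Finset.mem_insert_of_mem hi), mem_zeroSet.1 hi]
    simp

theorem GeneralPosition.exists_le_card_zeroSet {x : Fin N → Fin d → ℚ} (hx : GeneralPosition x)
    (hN : d < N) {σ : Fin N → ℚ} {a : Fin (d + 1) → ℚ}
    (hσa : ∀ i, 0 < σ i * affineEval a (x i)) :
    ∀ k ≤ d, ∃ a' : Fin (d + 1) → ℚ, a' ≠ 0 ∧ (∀ i, 0 ≤ σ i * affineEval a' (x i)) ∧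
      k ≤ (zeroSet x a').card := by
  have hσ : ∀ i, σ i ≠ 0 := fun i h => by simpa [h] using hσa i
  intro k
  induction k with
  | zero =>
    refine fun _ => ⟨a, fun h => ?_, fun i => (hσa i).le, Nat.zero_le _⟩
    simpa [h, affineEval] using hσa ⟨0, by omega⟩
  | succ k ih =>
    intro hk
    obtain ⟨a', ha', hσa', hcard⟩ := ih (by omega)
    by_cases h : k + 1 ≤ (zeroSet x a').card
    · exact ⟨a', ha', hσa', h⟩
    · obtain ⟨b, hb, hσb, hlt⟩ := hx.exists_card_zeroSet_lt hN hσ hσa' (by omega)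
      exact ⟨b, hb, hσb, by omega⟩

/-- Since `sgn 0 = 1`, points on the hyperplane belong to the positive side; raising the offset by a
small `ε` makes them strictly positive and leaves the negative ones negative. -/
theorem exists_affineEval_pos (x : Fin N → Fin d → ℚ) (a : Fin (d + 1) → ℚ) :
    ∃ a' : Fin (d + 1) → ℚ,
      ∀ i, 0 < (((sgn (affineEval a (x i)) : ℤˣ) : ℤ) : ℚ) * affineEval a' (x i) := by
  obtain ⟨ε, hε, hε'⟩ : ∃ ε : ℚ, 0 < ε ∧ ∀ i, affineEval a (x i) < 0 →
      affineEval a (x i) + ε < 0 := by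
    have : ∀ s : Finset (Fin N), ∃ ε : ℚ, 0 < ε ∧ ∀ i ∈ s, affineEval a (x i) < 0 →
        affineEval a (x i) + ε < 0 := by
      intro s
      induction s using Finset.induction_on with
      | empty => exact ⟨1, one_pos, by simp⟩
      | insert j s _ ih =>
        obtain ⟨ε, hε, h⟩ := ih
        rcases lt_or_ge (affineEval a (x j)) 0 with hj | hj
        · refine ⟨min ε (-affineEval a (x j) / 2), lt_min hε (by linarith), fun i hi hneg => ?_⟩
          rcases Finset.mem_insert.1 hi with rfl | hi
          · linarith [min_le_right ε (-affineEval a (x i) / 2)]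
          · linarith [min_le_left ε (-affineEval a (x j) / 2), h i hi hneg]
        · refine ⟨ε, hε, fun i hi hneg => ?_⟩
          rcases Finset.mem_insert.1 hi with rfl | hi
          · linarith
          · exact h i hi hneg
    simpa using this Finset.univ
  refine ⟨a + ε • Fin.snoc (0 : Fin d → ℚ) 1, fun i => ?_⟩
  have h₁ : affineEval (Fin.snoc (0 : Fin d → ℚ) 1) (x i) = 1 := by simp [affineEval]
  rw [affineEval_add, affineEval_smul, h₁, sgn]
  split_ifs with h
  · push_cast; linarith
  · have := hε' i (not_le.1 h)
    push_cast; linarith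

/-- Every linear classification of the data agrees, off a hyperplane through exactly `d` of the
points and up to exchanging the labels, with the classification by this hyperplane. -/
theorem GeneralPosition.exists_hyperplane {x : Fin N → Fin d → ℚ} (hx : GeneralPosition x)
    (hN : d < N) (a : Fin (d + 1) → ℚ) :
    ∃ (e : Fin d ↪o Fin N) (s : ℤˣ), ∀ i ∉ Set.range e,
      s * sgn (affineEval a (x i)) = sgn (affineEval (minorVector (x ∘ e)) (x i)) := by
  obtain ⟨a₁, ha₁⟩ := exists_affineEval_pos x a
  obtain ⟨a₂, ha₂, hσ, hcard⟩ := hx.exists_le_card_zeroSet hN ha₁ d le_rfl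
  have hcard' : (zeroSet x a₂).card = d := le_antisymm (hx.card_zeroSet_le ha₂) hcard
  let e := (zeroSet x a₂).orderEmbOfFin hcard'
  have he : ∀ k, affineEval a₂ (x (e k)) = 0 := fun k =>
    mem_zeroSet.1 (Finset.orderEmbOfFin_mem _ hcard' k)
  obtain ⟨t, ht, hte⟩ := hx.exists_eq_smul_minorVector hN e.injective ha₂ he
  -- The minor vector is `t • a₂`, so the sides are exchanged exactly when `t < 0`.
  refine ⟨e, sgn t, fun i hi => ?_⟩
  have hi0 : affineEval a₂ (x i) ≠ 0 := fun h => hi <| by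
    rw [← hx.affineEval_minorVector_eq_zero_iff e.injective, hte, affineEval_smul, h, mul_zero]
  have hi1 := hσ i
  rw [hte, affineEval_smul]
  unfold sgn at hi1 ⊢
  rcases lt_or_gt_of_ne ht with ht | ht <;> rcases lt_or_gt_of_ne hi0 with h | h <;>
    by_cases h' : 0 ≤ affineEval a (x i)
  all_goals
    simp only [h', if_true, if_false, ht.le, not_le.2 ht] at hi1 ⊢
    push_cast at hi1
    first
      | (exfalso; linarith)
      | (rw [if_pos (by nlinarith)]; rfl)
      | (rw [if_neg (by nlinarith)]; rfl)

end PWA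

namespace PWA

open Prog Matrix

variable {d N : ℕ} (ℓ : ℚ → ℚ)

/-! ### Values of the subroutines -/

theorem foldl_finRange_add (n : ℕ) (f : Fin n → ℚ) (s : ℚ) :
    (List.finRange n).foldl (fun s i => s + f i) s = s + ∑ i, f i := by
  have h : ∀ (l : List (Fin n)) (s : ℚ),
      l.foldl (fun s i => s + f i) s = s + (l.map f).sum := by
    intro l
    induction l with
    | nil => simp
    | cons a l ih => intro s; simp [ih, add_assoc]
  rw [h, ← List.ofFn_eq_map, List.sum_ofFn]

@[simp] theorem value_affineProg (v : Fin (d + 1) → ℚ) (x : Fin d → ℚ) :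
    (affineProg v x).value ℓ = affineEval v x := by
  simp [affineProg, affineEval, instrValue, foldl_finRange_add, add_comm]

@[simp] theorem value_detProg (n : ℕ) (M : Fin n → Fin n → ℚ) :
    (detProg n M).value ℓ = det (of M) := by
  induction n with
  | zero => simp [detProg, instrValue]
  | succ n ih =>
    rw [det_succ_row_zero, ← zero_add (∑ _, _), ← foldl_finRange_add]
    simp only [detProg, value_bind, value_forEach, value_instr, instrValue, ih]
    congr 1
    funext s j
    have h : (of M).submatrix Fin.succ j.succAbove = of fun i k => M i.succ (j.succAbove k) := rfl
    rw [h]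
    split_ifs with hj
    · simp [instrValue, hj.neg_one_pow]
    · simp [instrValue, (Nat.not_even_iff_odd.1 hj).neg_one_pow, sub_eq_add_neg]

@[simp] theorem value_hyperplaneProg (c : Fin d → DataPoint ℚ d) :
    (hyperplaneProg c).value ℓ = minorVector fun i => (c i).1 := by
  funext j
  simp only [hyperplaneProg, value_bind, value_tabulate, value_instr, instrValue, value_detProg,
    minorVector, homogenize]
  split_ifs with hj
  · simp [hj.neg_one_pow]
  · simp [instrValue, (Nat.not_even_iff_odd.1 hj).neg_one_pow]

@[simp] theorem value_absProg (u : ℚ) : (absProg u).value ℓ = |u| := by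
  simp only [absProg, value_bind, value_instr, instrValue, value_isLess, decide_eq_true_eq]
  split_ifs with h
  · simp [instrValue, abs_of_neg h]
  · simp [abs_of_nonneg (not_lt.1 h)]

theorem foldl_split {α : Type} (P Q : α → Prop) [DecidablePred P] [DecidablePred Q]
    (hPQ : ∀ a, P a → ¬ Q a) (l : List α) (s : List α × List α) :
    l.foldl (fun s p => if P p then (p :: s.1, s.2) else if Q p then (s.1, p :: s.2) else s) s =
      ((l.filter fun p => P p).reverse ++ s.1, (l.filter fun p => Q p).reverse ++ s.2) := by
  induction l generalizing s with
  | nil => simp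
  | cons a l ih =>
    rw [List.foldl_cons, ih]
    by_cases h : P a
    · simp [h, hPQ a h]
    · by_cases h' : Q a <;> simp [h, h']

@[simp] theorem value_splitProg (a : Fin (d + 1) → ℚ) (L : List (DataPoint ℚ d)) :
    (splitProg a L).value ℓ =
      ((L.filter fun p => 0 < affineEval a p.1).reverse,
        (L.filter fun p => affineEval a p.1 < 0).reverse) := by
  have h := foldl_split (fun p : DataPoint ℚ d => 0 < affineEval a p.1)
    (fun p => affineEval a p.1 < 0) (fun _ h => not_lt.2 h.le) L ([], [])
  simp only [List.append_nil] at h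
  simp only [splitProg, value_bind, value_instr, instrValue, value_isLess, value_affineProg,
    value_forEach, decide_eq_true_eq]
  rw [← h]
  congr 1
  funext s p
  split_ifs <;> rfl

@[simp] theorem value_addLabeled (c : Fin d → DataPoint ℚ d) (q : Fin d → ℤˣ)
    (s : List (DataPoint ℚ d) × List (DataPoint ℚ d)) :
    (addLabeled c q s).value ℓ =
      ((((List.finRange d).filter fun i => q i = 1).map c).reverse ++ s.1,
        (((List.finRange d).filter fun i => q i = -1).map c).reverse ++ s.2) := by
  simp only [addLabeled, value_forEach]
  generalize List.finRange d = l
  induction l generalizing s with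
  | nil => simp
  | cons i l ih =>
    rw [List.foldl_cons, ih]
    rcases Int.units_eq_one_or (q i) with h | h <;> simp [h]

@[simp] theorem value_lossSumProg (v : Fin (d + 1) → ℚ) (L : List (DataPoint ℚ d)) :
    (lossSumProg v L).value ℓ = (L.map fun p => ℓ (p.2 - affineEval v p.1)).sum := by
  simp only [lossSumProg, value_bind, value_instr, instrValue, value_affineProg, value_forEach]
  -- The induction needs an arbitrary initial accumulator.
  generalize hz : (0 : ℚ) = z
  rw [← zero_add (List.sum _), hz]
  clear hz
  induction L generalizing z with
  | nil => simp
  | cons a L ih => simp [ih, add_assoc]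

/-! ### Costs of the subroutines -/

/-- A bound on the number of steps of `detProg n`. -/
def detCost : ℕ → ℕ
  | 0 => 1
  | n + 1 => 1 + (n + 1) * (detCost n + 2 + 1)

theorem steps_detProg_le (n : ℕ) (M : Fin n → Fin n → ℚ) :
    (detProg n M).steps ℓ ≤ detCost n := by
  induction n with
  | zero => simp [detProg, detCost]
  | succ n ih =>
    simp only [detProg, steps_bind, steps_instr, detCost]
    refine Nat.add_le_add_left ((steps_forEach_le ℓ _ _ _ (b := detCost n + 2) ?_).trans ?_) 1
    · intro s j _
      have := ih fun i k => M i.succ (j.succAbove k)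
      split_ifs <;> simp only [steps_bind, steps_instr] <;> omega
    · simp

theorem steps_affineProg_le (v : Fin (d + 1) → ℚ) (x : Fin d → ℚ) :
    (affineProg v x).steps ℓ ≤ 3 * d := by
  refine (steps_forEach_le ℓ _ _ _ (b := 2) fun s i _ => ?_).trans ?_
  · simp
  · simp [mul_comm]

theorem steps_hyperplaneProg_le (c : Fin d → DataPoint ℚ d) :
    (hyperplaneProg c).steps ℓ ≤ 2 + (d + 1) * (detCost d + 2) := by
  simp only [hyperplaneProg, steps_bind, steps_instr]
  rw [← add_assoc]
  refine Nat.add_le_add_left (steps_tabulate_le ℓ _ _ (b := detCost d + 1) fun j => ?_) 2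
  have h := steps_detProg_le ℓ d
  split_ifs <;> simp only [steps_bind, steps_instr, steps_pure]
  · exact (h _).trans (Nat.le_succ _)
  · exact Nat.add_le_add_right (h _) 1

theorem steps_absProg_le (u : ℚ) : (absProg u).steps ℓ ≤ 3 := by
  simp only [absProg, steps_bind, steps_instr, steps_isLess]
  split_ifs <;> simp

theorem steps_splitProg_le (a : Fin (d + 1) → ℚ) (L : List (DataPoint ℚ d)) :
    (splitProg a L).steps ℓ ≤ 1 + L.length * (3 * d + 3) := by
  simp only [splitProg, steps_bind, steps_instr]
  refine Nat.add_le_add_left (steps_forEach_le ℓ _ _ _ (b := 3 * d + 2) fun s p _ => ?_) 1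
  have := steps_affineProg_le ℓ a p.1
  simp only [steps_bind, steps_isLess]
  split_ifs <;> simp only [steps_pure] <;> omega

theorem steps_addLabeled_le (c : Fin d → DataPoint ℚ d) (q : Fin d → ℤˣ)
    (s : List (DataPoint ℚ d) × List (DataPoint ℚ d)) :
    (addLabeled c q s).steps ℓ ≤ d := by
  refine (steps_forEach_le ℓ _ _ _ (b := 0) fun s i _ => ?_).trans ?_
  · split_ifs <;> simp
  · simp

theorem steps_lossSumProg_le (v : Fin (d + 1) → ℚ) (L : List (DataPoint ℚ d)) :
    (lossSumProg v L).steps ℓ ≤ 1 + L.length * (3 * d + 4) := by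
  simp only [lossSumProg, steps_bind, steps_instr]
  refine Nat.add_le_add_left (steps_forEach_le ℓ _ _ _ (b := 3 * d + 3) fun s p _ => ?_) 1
  have := steps_affineProg_le ℓ v p.1
  simp only [steps_bind, steps_instr]
  omega

theorem steps_tiltProg_le (a : Fin (d + 1) → ℚ) (c : Fin d → DataPoint ℚ d) (q : Fin d → ℤˣ)
    (L : List (DataPoint ℚ d)) :
    (tiltProg a c q L).steps ℓ ≤
      3 + (d + 1) * (detCost (d + 1) + 1) + L.length * (6 * d + 11) + (d + 1) * 3 := by
  simp only [tiltProg, steps_bind, steps_instr]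
  have h₁ := fun M : Fin (d + 1) → Fin (d + 1) → Fin (d + 1) → ℚ =>
    steps_tabulate_le ℓ (d + 1) (fun j => detProg (d + 1) (M j))
      fun i => steps_detProg_le ℓ (d + 1) (M i)
  have h₂ := fun (g : Fin (d + 1) → ℚ) (s : ℚ) => steps_forEach_le ℓ L s
    (fun ε p => do
      let u ← affineProg a p.1
      let v ← affineProg g p.1
      let absU ← absProg u
      let absV ← absProg v
      let den ← instr (.add absV (instrValue ℓ (.const 1)))
      let r ← instr (.div absU den)
      let isOff ← isLess (instrValue ℓ (.const 0)) r
      let isSmaller ← isLess r ε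
      pure (if isOff && isSmaller then r else ε)) (b := 6 * d + 10) fun s p _ => by
        have h₁ := steps_affineProg_le ℓ a p.1
        have h₂ := steps_affineProg_le ℓ g p.1
        have h₃ := steps_absProg_le ℓ (affineEval a p.1)
        have h₄ := steps_absProg_le ℓ (affineEval g p.1)
        simp only [steps_bind, steps_instr, steps_isLess, steps_pure, value_affineProg]
        omega
  have h₃ := fun (ε : ℚ) (g : Fin (d + 1) → ℚ) => steps_tabulate_le ℓ (d + 1) (fun j => do
    let p ← instr (.mul ε (g j))
    instr (.add (a j) p)) (b := 2) fun i => by simp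
  refine le_trans (b := 1 + (1 + (1 + ((d + 1) * (detCost (d + 1) + 1) +
    (L.length * (6 * d + 11) + (d + 1) * 3))))) ?_ (by omega)
  gcongr
  · exact h₁ _
  · exact h₂ _ _
  · exact h₃ _ _

/-! ### Tilting -/

/-- The fold is the minimum of `ε` and the positive values of `r`. Zero values, which come from
points on the hyperplane, must be skipped to keep the result positive. -/
theorem foldl_min_pos {α : Type} (r : α → ℚ) (l : List α) (ε : ℚ) (hε : 0 < ε) :
    0 < l.foldl (fun ε p => if 0 < r p ∧ r p < ε then r p else ε) ε ∧
      l.foldl (fun ε p => if 0 < r p ∧ r p < ε then r p else ε) ε ≤ ε ∧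
      ∀ p ∈ l, 0 < r p → l.foldl (fun ε p => if 0 < r p ∧ r p < ε then r p else ε) ε ≤ r p := by
  induction l generalizing ε with
  | nil => simpa using hε
  | cons p l ih =>
    simp only [List.foldl_cons]
    split_ifs with h
    · obtain ⟨h₁, h₂, h₃⟩ := ih _ h.1
      refine ⟨h₁, h₂.trans h.2.le, fun p' hp' hpos => ?_⟩
      rcases List.mem_cons.1 hp' with rfl | hp'
      · exact h₂
      · exact h₃ _ hp' hpos
    · obtain ⟨h₁, h₂, h₃⟩ := ih _ hε
      refine ⟨h₁, h₂, fun p' hp' hpos => ?_⟩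
      rcases List.mem_cons.1 hp' with rfl | hp'
      · exact h₂.trans (not_lt.1 fun hlt => h ⟨hpos, hlt⟩)
      · exact h₃ _ hp' hpos

/-- Cramer's rule without the division: `M *ᵥ cramer M target = det M • target`, and `det M` is the
product of `a` with the minor vector. The `+ 1` in the denominator of `r` excludes division by zero
and makes the last inequality strict. -/
theorem exists_value_tiltProg (a : Fin (d + 1) → ℚ) (c : Fin d → DataPoint ℚ d) (q : Fin d → ℤˣ)
    (L : List (DataPoint ℚ d)) :
    ∃ (ε : ℚ) (g : Fin (d + 1) → ℚ), (tiltProg a c q L).value ℓ = a + ε • g ∧ 0 < ε ∧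
      (∀ k, affineEval g (c k).1 = (a ⬝ᵥ minorVector fun i => (c i).1) * ((q k : ℤ) : ℚ)) ∧
      ∀ p ∈ L, affineEval a p.1 ≠ 0 → ε * |affineEval g p.1| < |affineEval a p.1| := by
  set M : Matrix (Fin (d + 1)) (Fin (d + 1)) ℚ :=
    of (Fin.cons a fun i => homogenize (c i).1 : Fin (d + 1) → Fin (d + 1) → ℚ) with hM
  set target : Fin (d + 1) → ℚ := Fin.cons 0 fun i => if q i = 1 then 1 else -1 with htarget
  set g := cramer M target with hg
  set r : DataPoint ℚ d → ℚ := fun p => |affineEval a p.1| / (|affineEval g p.1| + 1) with hr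
  have hg' : (fun j => det (of fun i k => if k = j then target i else M i k)) = g := by
    funext j
    rw [hg, cramer_apply]
    congr 1
    ext i k
    simp [updateCol_apply]
  obtain ⟨h₁, -, h₃⟩ := foldl_min_pos r L 1 one_pos
  refine ⟨_, g, ?_, h₁, fun k => ?_, fun p hp hpa => ?_⟩
  · funext j
    rw [← hg']
    simp only [tiltProg, value_bind, value_tabulate, value_forEach, value_instr, instrValue,
      value_affineProg, value_absProg, value_detProg, value_isLess, value_pure, Bool.and_eq_true,
      decide_eq_true_eq, Pi.add_apply, Pi.smul_apply, smul_eq_mul, hr, ← hg', htarget, hM,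
      homogenize, of_apply]
  · have h := congrFun (mulVec_cramer M target) k.succ
    rw [dotProduct_minorVector, affineEval_eq_dotProduct]
    rcases Int.units_eq_one_or (q k) with hq | hq <;>
      simpa [mulVec, hM, htarget, hq] using h
  · have hpos : 0 < |affineEval a p.1| := abs_pos.2 hpa
    have hden : 0 < |affineEval g p.1| + 1 := by positivity
    have h := h₃ p hp (div_pos hpos hden)
    rw [hr, le_div_iff₀ hden] at h
    linarith

end PWA

namespace PWA

open Prog

variable {d N : ℕ} (ℓ : ℚ → ℚ)

/-! ### The candidates of the exhaustive search -/

/-- The data of class `j` when the points `c` on the hyperplane are classified by `q`. -/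
def classData (c : Fin d → DataPoint ℚ d) (q : Fin d → ℤˣ) (L : List (DataPoint ℚ d)) (j : ℤˣ) :
    List (DataPoint ℚ d) :=
  (((List.finRange d).filter fun i => q i = j).map c).reverse ++
    (L.filter fun p =>
      0 < ((j : ℤ) : ℚ) * affineEval (minorVector fun i => (c i).1) p.1).reverse

/-- The candidate solution for the points `c` with labels `q`. -/
def candidate (regress : List (DataPoint ℚ d) → Prog ℚ (Fin (d + 1) → ℚ)) (N : ℕ)
    (L : List (DataPoint ℚ d)) (c : Fin d → DataPoint ℚ d) (q : Fin d → ℤˣ) : Best ℚ d where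
  J := (∑ j : ℤˣ, ((classData c q L j).map fun p =>
    ℓ (p.2 - affineEval ((regress (classData c q L j)).value ℓ) p.1)).sum) / N
  w := fun j => (regress (classData c q L j)).value ℓ
  hyperplane := minorVector fun i => (c i).1
  points := c
  labels := q

/-- The better one of the best solution so far and a new one. -/
def keepBetter (best : Option (Best ℚ d)) (new : Best ℚ d) : Option (Best ℚ d) :=
  match best with
  | none => some new
  | some old => if new.J < old.J then some new else some old

theorem exists_foldl_keepBetter_some (l : List (Best ℚ d)) (b₀ : Best ℚ d) :
    ∃ b, l.foldl keepBetter (some b₀) = some b ∧ b ∈ b₀ :: l ∧ ∀ b' ∈ b₀ :: l, b.J ≤ b'.J := by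
  induction l generalizing b₀ with
  | nil => exact ⟨b₀, rfl, by simp, by simp⟩
  | cons b₁ l ih =>
    simp only [List.foldl_cons, keepBetter]
    split_ifs with h
    · obtain ⟨b, hb, hmem, hle⟩ := ih b₁
      refine ⟨b, hb, List.mem_cons_of_mem _ hmem, fun b' hb' => ?_⟩
      rcases List.mem_cons.1 hb' with rfl | hb'
      · exact (hle b₁ (by simp)).trans h.le
      · exact hle b' hb'
    · obtain ⟨b, hb, hmem, hle⟩ := ih b₀
      refine ⟨b, hb, ?_, fun b' hb' => ?_⟩
      · simp only [List.mem_cons] at hmem ⊢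
        tauto
      · simp only [List.mem_cons] at hb'
        rcases hb' with rfl | rfl | hb'
        · exact hle _ (by simp)
        · exact (hle b₀ (by simp)).trans (not_lt.1 h)
        · exact hle _ (by simp [hb'])

theorem exists_foldl_keepBetter {l : List (Best ℚ d)} (hl : l ≠ []) :
    ∃ b, l.foldl keepBetter none = some b ∧ b ∈ l ∧ ∀ b' ∈ l, b.J ≤ b'.J := by
  cases l with
  | nil => exact absurd rfl hl
  | cons b₀ l => exact exists_foldl_keepBetter_some l b₀

theorem value_addLabeled_splitProg (c : Fin d → DataPoint ℚ d) (q : Fin d → ℤˣ)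
    (L : List (DataPoint ℚ d)) :
    (addLabeled c q ((splitProg (minorVector fun i => (c i).1) L).value ℓ)).value ℓ =
      (classData c q L 1, classData c q L (-1)) := by
  simp [classData]

/-- The nested loops amount to a single minimum search over the list of all pairs of a subset and a
labeling. -/
theorem value_searchProg (regress : List (DataPoint ℚ d) → Prog ℚ (Fin (d + 1) → ℚ))
    (D : Fin N → DataPoint ℚ d) :
    (searchProg regress D).value ℓ =
      ((subsets d (List.ofFn D)).flatMap fun c =>
        (labelings d).map (candidate ℓ regress N (List.ofFn D) c)).foldl keepBetter none := by
  rw [List.foldl_flatMap]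
  simp only [searchProg, value_bind, value_forSubsets, value_forLabelings, value_hyperplaneProg,
    value_addLabeled_splitProg, List.foldl_map]
  congr 1
  funext best c
  congr 1
  funext best q
  have hw : (fun j : ℤˣ => if j = 1 then (regress (classData c q (List.ofFn D) 1)).value ℓ
      else (regress (classData c q (List.ofFn D) (-1))).value ℓ) =
      fun j => (regress (classData c q (List.ofFn D) j)).value ℓ := by
    funext j
    rcases Int.units_eq_one_or j with rfl | rfl <;> simp
  cases best with
  | none => simp [keepBetter, candidate, instrValue, hw]
  | some old => simp [keepBetter, candidate, instrValue, hw]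

theorem mem_subsets_ofFn {α : Type} {k : ℕ} {D : Fin N → α} {c : Fin k → α} :
    c ∈ subsets k (List.ofFn D) ↔ ∃ e : Fin k ↪o Fin N, c = D ∘ e := by
  rw [mem_subsets, List.sublist_iff_exists_fin_orderEmbedding_get_eq]
  have hk : k = (List.ofFn c).length := by simp
  have hN : (List.ofFn D).length = N := by simp
  constructor
  · rintro ⟨f, hf⟩
    refine ⟨((Fin.castOrderIso hk).toOrderEmbedding.trans f).trans
      (Fin.castOrderIso hN).toOrderEmbedding, funext fun i => ?_⟩
    have := hf (Fin.cast hk i)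
    rw [List.get_ofFn, List.get_ofFn] at this
    exact this
  · rintro ⟨e, rfl⟩
    refine ⟨((Fin.castOrderIso hk.symm).toOrderEmbedding.trans e).trans
      (Fin.castOrderIso hN.symm).toOrderEmbedding, fun i => ?_⟩
    rw [List.get_ofFn, List.get_ofFn]
    rfl

/-! ### Correctness of the candidates -/

/-- The strict inequality in `classData` excludes the points of `e`, so each data point is counted
once, in the class of its label. A general monoid `M` serves both the loss sums and the counting of
points. -/
theorem sum_map_classData {M : Type*} [AddCommMonoid M] {D : Fin N → DataPoint ℚ d}
    (hD : GeneralPosition fun i => (D i).1) {e : Fin d → Fin N} (he : Function.Injective e)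
    {g : Fin N → ℤˣ}
    (hg : ∀ i ∉ Set.range e, g i = sgn (affineEval (minorVector fun k => (D (e k)).1) (D i).1))
    (j : ℤˣ) (f : DataPoint ℚ d → M) :
    ((classData (D ∘ e) (g ∘ e) (List.ofFn D) j).map f).sum =
      ∑ i, if g i = j then f (D i) else 0 := by
  classical
  have hsum : ∀ {α : Type} (l : List α) (P : α → Prop) [DecidablePred P] (f : α → M),
      ((l.filter fun a => P a).map f).sum = (l.map fun a => if P a then f a else 0).sum := by
    intro α l P _ f
    induction l with
    | nil => rfl
    | cons a l ih => by_cases h : P a <;> simp [h, ih]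
  have h₁ : ((((List.finRange d).filter fun i => g (e i) = j).map (D ∘ e)).map f).sum =
      ∑ i, if i ∈ Set.range e then (if g i = j then f (D i) else 0) else 0 := by
    rw [List.map_map, hsum, ← List.ofFn_eq_map, List.sum_ofFn,
      ← Finset.sum_filter (fun i => i ∈ Set.range e)]
    have : (Finset.univ.filter fun i => i ∈ Set.range e) = Finset.univ.image e := by
      ext; simp
    rw [this, Finset.sum_image fun _ _ _ _ h => he h]
    rfl
  rw [classData, List.map_append, List.sum_append, List.map_reverse, List.map_reverse,
    (List.reverse_perm _).sum_eq, (List.reverse_perm _).sum_eq]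
  simp only [Function.comp_apply]
  rw [h₁, hsum, List.map_ofFn, List.sum_ofFn, ← Finset.sum_add_distrib]
  refine Finset.sum_congr rfl fun i _ => ?_
  have hz := hD.affineEval_minorVector_eq_zero_iff he i
  change affineEval (minorVector fun k => (D (e k)).1) (D i).1 = 0 ↔ _ at hz
  by_cases hi : i ∈ Set.range e
  · simp [hi, hz.2 hi]
  · have hne := mt hz.1 hi
    have hiff : (0 < ((j : ℤ) : ℚ) * affineEval (minorVector fun k => (D (e k)).1) (D i).1) ↔
        g i = j := by
      rw [hg i hi, sgn]
      rcases lt_or_gt_of_ne hne with h | h <;>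
        rcases Int.units_eq_one_or j with rfl | rfl
      · simp [h.le, not_le.2 h]
      · simp [h, not_le.2 h]
      · simp [h, h.le]
      · simp [h.le]
    simp [hi, hiff]

theorem mem_of_mem_classData {D : Fin N → DataPoint ℚ d} {e : Fin d → Fin N} {q : Fin d → ℤˣ}
    {j : ℤˣ} {p : DataPoint ℚ d} (hp : p ∈ classData (D ∘ e) q (List.ofFn D) j) :
    p ∈ Set.range D := by
  simp only [classData, List.mem_append, List.mem_reverse, List.mem_map, List.mem_filter,
    List.mem_ofFn] at hp
  rcases hp with ⟨k, -, rfl⟩ | ⟨hp, -⟩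
  · exact ⟨e k, rfl⟩
  · exact hp

variable {ℓ} in
theorem candidate_J_eq {regress : List (DataPoint ℚ d) → Prog ℚ (Fin (d + 1) → ℚ)}
    {D : Fin N → DataPoint ℚ d}
    (hD : GeneralPosition fun i => (D i).1) {e : Fin d → Fin N} (he : Function.Injective e)
    {g : Fin N → ℤˣ}
    (hg : ∀ i ∉ Set.range e, g i = sgn (affineEval (minorVector fun k => (D (e k)).1) (D i).1)) :
    (candidate ℓ regress N (List.ofFn D) (D ∘ e) (g ∘ e)).J =
      (∑ i, ℓ ((D i).2 - affineEval
        ((candidate ℓ regress N (List.ofFn D) (D ∘ e) (g ∘ e)).w (g i)) (D i).1)) / N := by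
  simp only [candidate, sum_map_classData hD he hg]
  rw [Finset.sum_comm]
  simp only [Finset.sum_ite_eq, Finset.mem_univ, if_true]

variable {ℓ} in
-- The cost of a fixed classification splits into one regression problem per class, and each is
-- solved optimally.
theorem candidate_J_le {X : Set (Fin d → ℚ)}
    {regress : List (DataPoint ℚ d) → Prog ℚ (Fin (d + 1) → ℚ)} {T : ℕ → ℕ}
    (hr : SolvesRegression X ℓ regress T) {D : Fin N → DataPoint ℚ d} (hX : ∀ i, (D i).1 ∈ X)
    (hD : GeneralPosition fun i => (D i).1) {e : Fin d → Fin N} (he : Function.Injective e)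
    {g : Fin N → ℤˣ}
    (hg : ∀ i ∉ Set.range e, g i = sgn (affineEval (minorVector fun k => (D (e k)).1) (D i).1))
    (w : ℤˣ → Fin (d + 1) → ℚ) :
    (candidate ℓ regress N (List.ofFn D) (D ∘ e) (g ∘ e)).J ≤
      (∑ i, ℓ ((D i).2 - affineEval (w (g i)) (D i).1)) / N := by
  have h : ∑ i, ℓ ((D i).2 - affineEval (w (g i)) (D i).1) =
      ∑ j : ℤˣ, ((classData (D ∘ e) (g ∘ e) (List.ofFn D) j).map fun p =>
        ℓ (p.2 - affineEval (w j) p.1)).sum := by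
    simp only [sum_map_classData hD he hg]
    rw [Finset.sum_comm]
    simp only [Finset.sum_ite_eq, Finset.mem_univ, if_true]
  rw [h]
  simp only [candidate]
  gcongr with j
  refine (hr _ fun p hp => ?_).1 (w j)
  obtain ⟨i, rfl⟩ := mem_of_mem_classData hp
  exact hX i

theorem length_classData_le {D : Fin N → DataPoint ℚ d}
    (hD : GeneralPosition fun i => (D i).1) {e : Fin d → Fin N} (he : Function.Injective e)
    (q : Fin d → ℤˣ) (j : ℤˣ) : (classData (D ∘ e) q (List.ofFn D) j).length ≤ N := by
  -- Extending `q` by the sides of the hyperplane gives a labeling of all data; summing the constant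
  -- `1` over a class then yields its length.
  set g : Fin N → ℤˣ := Function.extend e q fun i =>
    sgn (affineEval (minorVector fun k => (D (e k)).1) (D i).1) with hg
  have hq : g ∘ e = q := funext fun k => by simp [hg, he.extend_apply]
  have h := sum_map_classData hD he (g := g)
    (fun i hi => Function.extend_apply' _ _ i fun ⟨k, hk⟩ => hi ⟨k, hk⟩) j (fun _ => (1 : ℕ))
  rw [hq] at h
  have h' : ((classData (D ∘ e) q (List.ofFn D) j).map fun _ => (1 : ℕ)).sum =
      (classData (D ∘ e) q (List.ofFn D) j).length := by simp
  rw [← h', h, ← Finset.sum_filter, Finset.sum_const, smul_eq_mul, mul_one]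
  exact (Finset.card_le_univ _).trans (by simp)

/-! ### The running time -/

/-- A bound on the cost of the loop body of the search, relative to the cost of regression. -/
def bodyCost (d : ℕ) : ℕ :=
  2 + (d + 1) * (detCost d + 2) + (1 + (3 * d + 3)) + 2 ^ d * (d + 2 + 2 * (3 * d + 5) + 5)

/-- The constant in the bound on the running time. -/
def algorithmCost (d : ℕ) : ℕ :=
  1 + (d + 1) * (bodyCost d + 1) * 2 ^ d +
    (3 + (d + 1) * (detCost (d + 1) + 1) + (6 * d + 11) + (d + 1) * 3)

variable {ℓ} in
theorem steps_searchProg_le {X : Set (Fin d → ℚ)}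
    {regress : List (DataPoint ℚ d) → Prog ℚ (Fin (d + 1) → ℚ)} {T : ℕ → ℕ}
    (hr : SolvesRegression X ℓ regress T) (hT : N ≤ T N) (hN : 1 ≤ N)
    {D : Fin N → DataPoint ℚ d} (hX : ∀ i, (D i).1 ∈ X)
    (hD : GeneralPosition fun i => (D i).1) :
    (searchProg regress D).steps ℓ ≤
      1 + (d + 1) * (bodyCost d * T N + 1) * (N + 1) ^ d := by
  simp only [searchProg, steps_bind, steps_instr]
  gcongr
  refine (steps_forSubsets_le ℓ _ _ _ _ (b := bodyCost d * T N) fun best c hc => ?_).trans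
    (by simp)
  obtain ⟨e, rfl⟩ := mem_subsets_ofFn.1 hc
  simp only [steps_bind, value_hyperplaneProg]
  have hT1 : 1 ≤ T N := hN.trans hT
  have h₁ := steps_hyperplaneProg_le ℓ (D ∘ e)
  have h₂ := steps_splitProg_le ℓ (minorVector fun i => ((D ∘ e) i).1) (List.ofFn D)
  rw [List.length_ofFn] at h₂
  have hloss : ∀ (v : Fin (d + 1) → ℚ) (q : Fin d → ℤˣ) (j : ℤˣ),
      (lossSumProg v (classData (D ∘ e) q (List.ofFn D) j)).steps ℓ ≤ (3 * d + 5) * T N := by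
    intro v q j
    refine (steps_lossSumProg_le ℓ _ _).trans ?_
    have := Nat.mul_le_mul_right (3 * d + 4)
      ((length_classData_le hD e.injective q j).trans hT)
    nlinarith
  have hreg : ∀ (q : Fin d → ℤˣ) (j : ℤˣ),
      (regress (classData (D ∘ e) q (List.ofFn D) j)).steps ℓ ≤ T N := by
    intro q j
    refine (hr _ fun p hp => ?_).2 N (length_classData_le hD e.injective q j)
    obtain ⟨i, rfl⟩ := mem_of_mem_classData hp
    exact hX i
  -- The summands of `b` are the labeling loop, two regressions, two loss sums, and at most three
  -- steps for the addition, the division and the comparison.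
  refine (Nat.add_le_add h₁ (Nat.add_le_add h₂ (steps_forLabelings_le ℓ _ _ _
    (b := d + (T N + (T N + ((3 * d + 5) * T N + ((3 * d + 5) * T N + 3))))) fun s q => ?_))).trans ?_
  · simp only [steps_bind, value_addLabeled_splitProg]
    refine Nat.add_le_add (steps_addLabeled_le ℓ _ _ _) (Nat.add_le_add (hreg _ _)
      (Nat.add_le_add (hreg _ _) (Nat.add_le_add (hloss _ _ _)
        (Nat.add_le_add (hloss _ _ _) ?_))))
    cases s <;> simp
  · have h₃ : 2 + (d + 1) * (detCost d + 2) ≤ (2 + (d + 1) * (detCost d + 2)) * T N :=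
      Nat.le_mul_of_pos_right _ hT1
    have h₄ : 1 + N * (3 * d + 3) ≤ (1 + (3 * d + 3)) * T N := by nlinarith
    have h₅ : d + (T N + (T N + ((3 * d + 5) * T N + ((3 * d + 5) * T N + 3)))) + 2 ≤
        (d + 2 + 2 * (3 * d + 5) + 5) * T N := by nlinarith
    have h₆ := Nat.mul_le_mul_left (2 ^ d) h₅
    exact (Nat.add_le_add h₃ (Nat.add_le_add h₄ h₆)).trans_eq (by rw [bodyCost]; ring)

variable {ℓ} in
theorem steps_exactAlgorithm_le {X : Set (Fin d → ℚ)}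
    {regress : List (DataPoint ℚ d) → Prog ℚ (Fin (d + 1) → ℚ)} {T : ℕ → ℕ}
    (hr : SolvesRegression X ℓ regress T) (hT : N ≤ T N) (hN : 1 ≤ N)
    {D : Fin N → DataPoint ℚ d} (hX : ∀ i, (D i).1 ∈ X)
    (hD : GeneralPosition fun i => (D i).1) :
    (exactAlgorithm regress D).steps ℓ ≤ algorithmCost d * T N * N ^ d := by
  have hT1 : 1 ≤ T N := hN.trans hT
  have hNd : 1 ≤ N ^ d := Nat.one_le_pow _ _ hN
  have hTN : T N ≤ T N * N ^ d := Nat.le_mul_of_pos_right _ hNd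
  set K := 3 + (d + 1) * (detCost (d + 1) + 1) + (6 * d + 11) + (d + 1) * 3 with hK
  have h₁ := steps_searchProg_le hr hT hN hX hD
  have h₂ : (d + 1) * (bodyCost d * T N + 1) * (N + 1) ^ d ≤
      (d + 1) * (bodyCost d + 1) * 2 ^ d * (T N * N ^ d) := by
    have : (N + 1) ^ d ≤ 2 ^ d * N ^ d := by
      rw [← mul_pow]; exact Nat.pow_le_pow_left (by omega) d
    calc (d + 1) * (bodyCost d * T N + 1) * (N + 1) ^ d
        ≤ (d + 1) * ((bodyCost d + 1) * T N) * (2 ^ d * N ^ d) := by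
          gcongr
          linarith
      _ = _ := by ring
  have h₃ : ∀ b : Best ℚ d, (tiltProg b.hyperplane b.points b.labels (List.ofFn D)).steps ℓ ≤
      K * (T N * N ^ d) := by
    intro b
    refine (steps_tiltProg_le ℓ _ _ _ _).trans ?_
    rw [List.length_ofFn]
    have h₄ : 3 + (d + 1) * (detCost (d + 1) + 1) + N * (6 * d + 11) + (d + 1) * 3 ≤
        K * T N := by
      rw [hK]
      generalize (d + 1) * (detCost (d + 1) + 1) = A
      nlinarith [Nat.mul_le_mul_left A hT1]
    exact h₄.trans (Nat.mul_le_mul_left K hTN)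
  rw [exactAlgorithm, steps_bind, algorithmCost, ← hK, mul_assoc, add_mul, add_mul, one_mul]
  refine Nat.add_le_add (h₁.trans (by omega)) ?_
  generalize (searchProg regress D).value ℓ = o
  cases o with
  | none => simp
  | some b =>
    simp only [steps_bind, steps_pure, add_zero]
    exact h₃ b

/-! ### Correctness of the algorithm -/

theorem pwaCost_eq {X : Set (Fin d → ℚ)} (D : Fin N → X × ℚ) (w : ℤˣ → Fin (d + 1) → ℚ)
    (h : X → ℤˣ) :
    pwaCost ℓ D w h = (∑ i, ℓ ((D i).2 - affineEval (w (h (D i).1)) (D i).1.1)) / N := by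
  simp only [pwaCost, Finset.sum_ite_eq, Finset.mem_univ, if_true]
  rw [one_div_mul_eq_div]

theorem sgn_add_of_abs_lt {u v : ℚ} (h : |v| < |u|) : sgn (u + v) = sgn u := by
  unfold sgn
  rcases abs_cases u with ⟨h₁, h₂⟩ | ⟨h₁, h₂⟩ <;> rw [h₁, abs_lt] at h
  · rw [if_pos (by linarith), if_pos h₂]
  · rw [if_neg (by linarith), if_neg (by linarith)]

theorem sgn_mul_units {u : ℚ} (hu : 0 < u) (j : ℤˣ) : sgn (u * ((j : ℤ) : ℚ)) = j := by
  unfold sgn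
  rcases Int.units_eq_one_or j with rfl | rfl
  · simp [hu.le]
  · simp [hu]

/-- The tilted hyperplane classifies the points `c` as prescribed, and the others as before. -/
theorem sgn_value_tiltProg {D : Fin N → DataPoint ℚ d}
    (hD : GeneralPosition fun i => (D i).1) (hN : d < N) {e : Fin d → Fin N}
    (he : Function.Injective e) (q : Fin d → ℤˣ) :
    let a := minorVector fun k => (D (e k)).1
    let a' := (tiltProg a (D ∘ e) q (List.ofFn D)).value ℓ
    (∀ k, sgn (affineEval a' (D (e k)).1) = q k) ∧
      ∀ i ∉ Set.range e, sgn (affineEval a' (D i).1) = sgn (affineEval a (D i).1) := by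
  intro a a'
  obtain ⟨ε, g, hεg, hε, hg, hlt⟩ := exists_value_tiltProg ℓ a (D ∘ e) q (List.ofFn D)
  have hz : ∀ i, affineEval a (D i).1 = 0 ↔ i ∈ Set.range e :=
    hD.affineEval_minorVector_eq_zero_iff he
  -- As `a` is itself the minor vector, the determinant in Cramer's rule is a sum of squares, so the
  -- tilt has the prescribed signs.
  have hpos : 0 < a ⬝ᵥ a := by
    refine lt_of_le_of_ne (Finset.sum_nonneg fun i _ => mul_self_nonneg _) (Ne.symm ?_)
    rw [Ne, dotProduct_self_eq_zero]
    exact hD.minorVector_ne_zero hN he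
  have heval : ∀ x, affineEval a' x = affineEval a x + ε * affineEval g x := fun x => by
    rw [← affineEval_smul, ← affineEval_add, ← hεg]
  refine ⟨fun k => ?_, fun i hi => ?_⟩
  · rw [heval, (hz (e k)).2 ⟨k, rfl⟩, zero_add]
    have := hg k
    simp only [Function.comp_apply] at this
    rw [this, ← mul_assoc]
    exact sgn_mul_units (mul_pos hε hpos) _
  · rw [heval]
    refine sgn_add_of_abs_lt ?_
    rw [abs_mul, abs_of_pos hε]
    exact hlt _ (List.mem_ofFn.2 ⟨i, rfl⟩) (mt (hz i).1 hi)

end PWA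

/-! ### Global optimality and the running time together. -/

theorem mainTheorem7 (d : ℕ) (hd : 1 ≤ d) :
    ∃ C : ℕ, ∀ (X : Set (Fin d → ℚ)) (ℓ : ℚ → ℚ) (_ : ∀ e, 0 ≤ ℓ e)
      (regress : List (PWA.DataPoint ℚ d) → PWA.Prog ℚ (Fin (d + 1) → ℚ)) (T : ℕ → ℕ)
      (_ : PWA.SolvesRegression X ℓ regress T)
      (_ : ∀ N, N ≤ T N)
      (_ : ∃ p : Polynomial ℕ, ∀ N, T N ≤ p.eval N),
      -- the bound on the running time is polynomial in `N`
      (∃ P : Polynomial ℕ, ∀ N : ℕ, C * T N * N ^ d ≤ P.eval N) ∧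
      ∀ (N : ℕ) (_ : 2 * (d + 1) ≤ N) (D : Fin N → X × ℚ)
        (_ : PWA.GeneralPosition fun i => (D i).1.1),
        -- the algorithm takes `T(N) O(N^d)` steps
        (PWA.exactAlgorithm regress fun i => ((D i).1.1, (D i).2)).steps ℓ ≤ C * T N * N ^ d ∧
        ∃ o : PWA.Output ℚ d,
          (PWA.exactAlgorithm regress fun i => ((D i).1.1, (D i).2)).value ℓ = some o ∧
          -- and it returns a global solution with its error
          PWA.IsGlobalSolution ℓ D o.w (PWA.linearClassifier X o.classifier) ∧
          o.J = PWA.pwaCost ℓ D o.w (PWA.linearClassifier X o.classifier) ∧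
          -- whose classification is given by a hyperplane through exactly `d` of the points
          (Finset.univ.filter fun i : Fin N =>
            PWA.affineEval o.hyperplane (D i).1.1 = 0).card = d ∧
          ∀ i : Fin N, PWA.affineEval o.hyperplane (D i).1.1 ≠ 0 →
            PWA.linearClassifier X o.classifier (D i).1 =
              PWA.linearClassifier X o.hyperplane (D i).1 := by
  open PWA Prog in
  refine ⟨algorithmCost d, fun X ℓ _ regress T hr hT ⟨p, hp⟩ =>
    ⟨⟨Polynomial.C (algorithmCost d) * p * Polynomial.X ^ d, fun N => ?_⟩, fun N hN D hD => ?_⟩⟩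
  · simp only [Polynomial.eval_mul, Polynomial.eval_C, Polynomial.eval_pow, Polynomial.eval_X]
    gcongr
    exact hp N
  set D' : Fin N → DataPoint ℚ d := fun i => ((D i).1.1, (D i).2) with hD'
  have hX : ∀ i, (D' i).1 ∈ X := fun i => (D i).1.2
  have hdN : d < N := by omega
  refine ⟨steps_exactAlgorithm_le hr (hT N) (by omega) hX hD, ?_⟩
  set l := (subsets d (List.ofFn D')).flatMap fun c =>
    (labelings d).map (candidate ℓ regress N (List.ofFn D') c) with hl
  have hmem : ∀ (e : Fin d ↪o Fin N) (q : Fin d → ℤˣ),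
      candidate ℓ regress N (List.ofFn D') (D' ∘ e) q ∈ l := fun e q =>
    List.mem_flatMap.2 ⟨_, mem_subsets_ofFn.2 ⟨e, rfl⟩, List.mem_map.2 ⟨q, mem_labelings q, rfl⟩⟩
  obtain ⟨b, hb, hbl, hmin⟩ := exists_foldl_keepBetter (l := l)
    -- The first `d` points, all labeled `1`, show that there is a candidate, so the search does not
    -- return `none`.
    (List.ne_nil_of_mem (hmem (Fin.castLEOrderEmb hdN.le) 1))
  rw [hl, ← value_searchProg] at hb
  obtain ⟨c, hc, hbq⟩ := List.mem_flatMap.1 hbl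
  obtain ⟨e, rfl⟩ := mem_subsets_ofFn.1 hc
  obtain ⟨q, -, rfl⟩ := List.mem_map.1 hbq
  set b := candidate ℓ regress N (List.ofFn D') (D' ∘ e) q with hbdef
  set a := (tiltProg b.hyperplane b.points b.labels (List.ofFn D')).value ℓ with ha
  obtain ⟨htilt, htilt'⟩ := sgn_value_tiltProg ℓ (D := D') hD hdN e.injective q
  change ∀ k, sgn (affineEval a (D' (e k)).1) = q k at htilt
  change ∀ i ∉ Set.range e, sgn (affineEval a (D' i).1) =
    sgn (affineEval b.hyperplane (D' i).1) at htilt'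
  have hz : ∀ i, affineEval b.hyperplane (D i).1.1 = 0 ↔ i ∈ Set.range e :=
    hD.affineEval_minorVector_eq_zero_iff e.injective
  have hJ : b.J = pwaCost ℓ D b.w (linearClassifier X a) := by
    rw [pwaCost_eq]
    have := candidate_J_eq (ℓ := ℓ) (regress := regress) (D := D') hD e.injective
      (g := fun i => sgn (affineEval a (D' i).1)) htilt'
    rwa [show (fun i => sgn (affineEval a (D' i).1)) ∘ e = q from funext htilt] at this
  refine ⟨⟨b.J, b.w, b.hyperplane, a⟩, ?_, ⟨⟨a, rfl⟩, ?_⟩, hJ,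
    hD.card_zeroSet_minorVector e.injective, fun i hi => htilt' i (mt (hz i).2 hi)⟩
  · simp only [exactAlgorithm, value_bind, hb, value_pure, ha]
  · rintro w' _ ⟨a', rfl⟩
    obtain ⟨e', s, hs⟩ := hD.exists_hyperplane hdN a'
    -- The submodels are permuted by `s` to compensate for the possible exchange of labels; `s * s =
    -- 1` restores the original cost.
    have h₁ := candidate_J_le hr hX hD e'.injective hs (fun j => w' (s * j))
    refine (hJ.ge.trans (hmin _ (hmem e' _))).trans (h₁.trans_eq ?_)
    rw [pwaCost_eq]
    simp only [← mul_assoc, Int.units_mul_self, one_mul]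
    rfl
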